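/- For a ternary cubic form $f\in\mathbb{C}[x,y,z]$ let $\mathcal{H}(f)$ be the determinant of the $3\times 3$ matrix of second partial derivatives of $f$; it is again a cubic form (possibly $0$). Plane cubics $V(f)\subseteq\mathbb{P}^2_{\mathbb{C}}$ are regarded as cubic forms up to multiplication by a nonzero constant (that is, as subschemes, so that $V(f)=V(g)$ means $f=cg$ with $c\in\mathbb{C}^\times$; we also allow $f=0$ so that the following operation is always defined), and the Hesse derivative of $E=V(f)$ is $\mathrm{Hesse}(E)=V(\mathcal{H}(f))$. The $j$-invariant of a plane cubic that some projective linear change of coordinates takes to a Weierstrass form $V(y^2z-x^3-axz^2-bz^3)$, $a,b\in\mathbb{C}$, is $$j=1728\cdot\frac{4a^3}{4a^3+27b^2}\in\widehat{\mathbb{C}}=\mathbb{C}\cup\{\infty\},$$ where the value is $\infty$ if $4a^3+27b^2=0$. (Every smooth plane cubic has such a form, with $4a^3+27b^2\neq0$; cubics without a Weierstrass form are given $j=\infty$.) Let $H:\widehat{\mathbb{C}}\to\widehat{\mathbb{C}}$ be the rational function $$H(j)=\frac{(6912-j)^3}{27j^2},\qquad H(0)=H(\infty)=\infty,$$ and call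 $p\in\widehat{\mathbb{C}}$ a periodic point of $H$ if $H^{\circ m}(p)=p$ for some integer $m\ge 1$. **Theorem.** Let $E\subseteq\mathbb{P}^2_{\mathbb{C}}$ be a smooth plane cubic whose $j$-invariant $j(E)$ lies in $\mathbb{C}$ and is a periodic point of $H$. Then there exists an integer $n\ge 1$ such that $\mathrm{Hesse}^n(E)=E$, the $n$-fold Hesse derivative being equal to $E$ as a plane curve, not merely isomorphic to it. -/

import Mathlib

open MvPolynomial

noncomputable section

/-- Ternary cubic forms over `ℂ` (the coordinates `x, y, z` are `X 0, X 1, X 2`). -/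
abbrev CubicForm : Type := homogeneousSubmodule (Fin 3) ℂ 3

/-- The plane cubic `V(f)`: a ternary cubic form up to multiplication by a nonzero constant.
The class of the zero form is kept, so that the Hesse derivative is defined everywhere; it is
never smooth. -/
abbrev PlaneCubic : Type := MulAction.orbitRel.Quotient ℂˣ CubicForm

/-- The plane cubic `V(f)` defined by the form `f`. -/
def PlaneCubic.V (f : CubicForm) : PlaneCubic := Quotient.mk _ f

theorem PlaneCubic.V_eq_V_iff {f g : CubicForm} :
    PlaneCubic.V f = PlaneCubic.V g ↔ ∃ c : ℂˣ, c • g = f := by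
  unfold PlaneCubic.V
  rw [Quotient.eq, MulAction.orbitRel_apply]
  rfl

/-- The determinant of the Hesse matrix of second partial derivatives. -/
def hessian (f : MvPolynomial (Fin 3) ℂ) : MvPolynomial (Fin 3) ℂ :=
  (Matrix.of fun i j : Fin 3 => pderiv i (pderiv j f)).det

theorem hessian_isHomogeneous {f : MvPolynomial (Fin 3) ℂ} (hf : f.IsHomogeneous 3) :
    (hessian f).IsHomogeneous 3 := by
  have h : ∀ i j : Fin 3, (pderiv i (pderiv j f)).IsHomogeneous 1 := fun i j =>
    (hf.pderiv (i := j)).pderiv (i := i)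
  unfold hessian
  rw [Matrix.det_apply]
  refine IsHomogeneous.sum _ _ _ fun s _ => ?_
  have hp : (∏ i : Fin 3, (Matrix.of fun i j : Fin 3 => pderiv i (pderiv j f)) (s i) i).IsHomogeneous
      (∑ _i : Fin 3, 1) := IsHomogeneous.prod _ _ _ fun i _ => h (s i) i
  have hp' : (∏ i : Fin 3, (Matrix.of fun i j : Fin 3 => pderiv i (pderiv j f)) (s i) i) ∈
      homogeneousSubmodule (Fin 3) ℂ 3 := by simpa using hp
  rcases Int.units_eq_one_or (Equiv.Perm.sign s) with hs | hs
  · rw [hs, one_smul]; exact hp'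
  · rw [hs, Units.neg_smul, one_smul]; exact Submodule.neg_mem _ hp'

theorem hessian_smul (c : ℂ) (f : MvPolynomial (Fin 3) ℂ) :
    hessian (c • f) = c ^ 3 • hessian f := by
  have h : (Matrix.of fun i j : Fin 3 => pderiv i (pderiv j (c • f))) =
      (C c : MvPolynomial (Fin 3) ℂ) • (Matrix.of fun i j : Fin 3 => pderiv i (pderiv j f)) := by
    ext1 i j
    simp [smul_eq_C_mul]
  unfold hessian
  rw [h, Matrix.det_smul, Fintype.card_fin, smul_eq_C_mul, C_pow]

/-- The Hesse determinant of a cubic form, as a cubic form. -/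
def CubicForm.hessian (f : CubicForm) : CubicForm :=
  ⟨_root_.hessian f.1, hessian_isHomogeneous f.2⟩

namespace PlaneCubic

/-- The Hesse derivative of a plane cubic: it sends `V(f)` to `V(hessian f)`. -/
def hesse : PlaneCubic → PlaneCubic :=
  Quotient.lift (fun f => V f.hessian) (by
    intro f g hfg
    obtain ⟨c, rfl⟩ := MulAction.orbitRel_apply.mp hfg
    refine V_eq_V_iff.mpr ⟨c ^ 3, Subtype.ext ?_⟩
    exact (hessian_smul (c : ℂ) g.1).symm)

theorem hesse_V (f : CubicForm) : hesse (V f) = V f.hessian := rfl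

/-- A plane cubic is smooth if at no point of it in the projective plane all the partial
derivatives of a defining form vanish. -/
def IsSmooth (E : PlaneCubic) : Prop :=
  ∀ f : CubicForm, V f = E → ∀ v : Fin 3 → ℂ, v ≠ 0 → eval v f.1 = 0 →
    ∃ i : Fin 3, eval v (pderiv i f.1) ≠ 0

/-- The polynomial `y²z - x³ - a x z² - b z³`. -/
def weierstrass (a b : ℂ) : MvPolynomial (Fin 3) ℂ :=
  X 1 ^ 2 * X 2 - X 0 ^ 3 - C a * X 0 * X 2 ^ 2 - C b * X 2 ^ 3

/-- The linear change of coordinates `f ↦ f(g x)`. -/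
def changeCoords (g : GL (Fin 3) ℂ) (f : MvPolynomial (Fin 3) ℂ) : MvPolynomial (Fin 3) ℂ :=
  bind₁ (fun i => ∑ j, C (g.1 i j) * X j) f

/-- `y²z = x³ + a x z² + b z³` is a Weierstrass form of `E`: a projective change of coordinates
takes `E` to this curve. -/
def HasWeierstrassForm (E : PlaneCubic) (a b : ℂ) : Prop :=
  ∃ (f : CubicForm) (g : GL (Fin 3) ℂ), V f = E ∧ changeCoords g f.1 = weierstrass a b

open Classical in
/-- The number `1728 · 4a³ / (4a³ + 27b²)` on the Riemann sphere. -/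
def jOfWeierstrass (a b : ℂ) : OnePoint ℂ :=
  if 4 * a ^ 3 + 27 * b ^ 2 = 0 then OnePoint.infty
  else ((1728 * (4 * a ^ 3 / (4 * a ^ 3 + 27 * b ^ 2)) : ℂ) : OnePoint ℂ)

open Classical in
/-- The `j`-invariant of a plane cubic, computed from a Weierstrass form of it. Every smooth cubic
has a Weierstrass form; the value is `∞` on the degenerate cubics that have none. -/
def jInvariant (E : PlaneCubic) : OnePoint ℂ :=
  if h : ∃ p : ℂ × ℂ, HasWeierstrassForm E p.1 p.2 then
    jOfWeierstrass h.choose.1 h.choose.2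
  else OnePoint.infty

end PlaneCubic

/-- The rational function `H(j) = (6912 - j)³ / (27 j²)` on the Riemann sphere. -/
def hesseJ : OnePoint ℂ → OnePoint ℂ
  | none => OnePoint.infty
  | some z => if z = 0 then OnePoint.infty
      else (((6912 - z) ^ 3 / (27 * z ^ 2) : ℂ) : OnePoint ℂ)

end

noncomputable section

/-! ### The Hesse derivative commutes with linear changes of coordinates -/

/-! Since the Hesse derivative commutes with coordinate changes (`PlaneCubic.semiconj_map_hesse`),
`E` may be replaced by a member of the Hesse pencil with the same `j`. On the pencil the Hesse
derivative is the rational map `hesseParam` of the parameter `k`, and `pencilJ` semiconjugates it to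
`hesseJ` (`hesseJ_pencilJ`).

If `hesseJ^[m]` fixes `j`, then `hesseParam^[m]` preserves the finite fibre of `pencilJ` over `j`.
This alone makes `k` only preperiodic. But the symmetries of the pencil commute with `hesseParam`
and act transitively on the fibre (`exists_isPencilSymmetry`), so the restricted map is surjective,
hence a permutation of a finite set, and `k` is periodic (`mem_periodicPts_hesseParam`).

The value `j = 0` is never periodic, which keeps `k` away from the points where `hesseParam` or the
next member degenerates. -/

theorem pderiv_bind₁ {σ τ R : Type*} [Fintype σ] [CommRing R] (φ : σ → MvPolynomial τ R)
    (i : τ) (f : MvPolynomial σ R) :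
    pderiv i (bind₁ φ f) = ∑ j, bind₁ φ (pderiv j f) * pderiv i (φ j) := by
  classical
  induction f using MvPolynomial.induction_on with
  | C a => simp
  | add p q hp hq => simp only [map_add, hp, hq, add_mul, Finset.sum_add_distrib]
  | mul_X p n hp =>
    simp only [map_mul, bind₁_X_right, pderiv_mul, map_add, hp, pderiv_X, add_mul,
      Finset.sum_add_distrib]
    congr 1
    · rw [Finset.sum_mul]
      exact Finset.sum_congr rfl fun _ _ => by ring
    · rw [Finset.sum_eq_single n]
      · simp
      · intro b _ hb
        simp [hb.symm]
      · simp

theorem pderiv_linearForm {σ τ R : Type*} [Fintype τ] [CommRing R] (M : Matrix σ τ R)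
    (i : τ) (j : σ) :
    pderiv i (∑ l, C (M j l) * X l : MvPolynomial τ R) = C (M j i) := by
  classical
  simp [Derivation.leibniz, pderiv_X, Pi.single_apply]

/-- The substitution is linear, so the chain rule applied twice turns the Hesse matrix `M` of `f`
into `gᵀ (M ∘ g) g`, and each outer factor contributes one `det g`. -/
theorem hessian_changeCoords (g : GL (Fin 3) ℂ) (f : MvPolynomial (Fin 3) ℂ) :
    hessian (PlaneCubic.changeCoords g f) =
      g.1.det ^ 2 • PlaneCubic.changeCoords g (hessian f) := by
  have key : (Matrix.of fun i j : Fin 3 => pderiv i (pderiv j (PlaneCubic.changeCoords g f))) =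
      (g.1.map C).transpose * ((Matrix.of fun i j : Fin 3 => pderiv i (pderiv j f)).map
        (bind₁ fun i => ∑ j, C (g.1 i j) * X j)) * g.1.map C := by
    refine Matrix.ext fun i j => ?_
    simp only [Matrix.of_apply, PlaneCubic.changeCoords, pderiv_bind₁, pderiv_linearForm]
    rw [map_sum]
    simp only [Derivation.leibniz, pderiv_C, pderiv_bind₁, pderiv_linearForm, mul_zero, zero_add,
      smul_eq_mul, Matrix.mul_apply, Matrix.of_apply, Matrix.map_apply, Matrix.transpose_apply,
      Finset.sum_mul, Finset.mul_sum]
    exact Finset.sum_congr rfl fun a _ => Finset.sum_congr rfl fun b _ => by ring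
  unfold hessian
  rw [key, Matrix.det_mul, Matrix.det_mul, Matrix.det_transpose, smul_eq_C_mul, C_pow,
    PlaneCubic.changeCoords, RingHom.map_det C g.1, AlgHom.map_det]
  simp only [RingHom.mapMatrix_apply, AlgHom.mapMatrix_apply]
  ring

theorem changeCoords_smul (g : GL (Fin 3) ℂ) (c : ℂ) (f : MvPolynomial (Fin 3) ℂ) :
    PlaneCubic.changeCoords g (c • f) = c • PlaneCubic.changeCoords g f :=
  map_smul _ _ _

theorem changeCoords_one (f : MvPolynomial (Fin 3) ℂ) : PlaneCubic.changeCoords 1 f = f := by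
  have : (fun i : Fin 3 => ∑ j, C ((1 : GL (Fin 3) ℂ).1 i j) * X j) =
      (X : Fin 3 → MvPolynomial (Fin 3) ℂ) := by
    funext i
    simp [Matrix.one_apply]
  rw [PlaneCubic.changeCoords, this, bind₁_X_left, AlgHom.id_apply]

theorem changeCoords_changeCoords (g g' : GL (Fin 3) ℂ) (f : MvPolynomial (Fin 3) ℂ) :
    PlaneCubic.changeCoords g (PlaneCubic.changeCoords g' f) =
      PlaneCubic.changeCoords (g' * g) f := by
  unfold PlaneCubic.changeCoords
  rw [bind₁_bind₁]
  congr 2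
  funext i
  simp only [map_sum, map_mul, bind₁_C_right, bind₁_X_right, Units.val_mul, Matrix.mul_apply,
    Finset.sum_mul, Finset.mul_sum]
  rw [Finset.sum_comm]
  exact Finset.sum_congr rfl fun a _ => Finset.sum_congr rfl fun b _ => by ring

theorem changeCoords_isHomogeneous (g : GL (Fin 3) ℂ) {f : MvPolynomial (Fin 3) ℂ} {n : ℕ}
    (hf : f.IsHomogeneous n) : (PlaneCubic.changeCoords g f).IsHomogeneous n := by
  have := hf.aeval (fun i => ∑ j, C (g.1 i j) * X j) (n := 1) fun i =>
    IsHomogeneous.sum _ _ _ fun j _ => isHomogeneous_C_mul_X _ _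
  rwa [one_mul] at this

/-- A linear change of coordinates, on cubic forms. -/
def CubicForm.changeCoords (g : GL (Fin 3) ℂ) (f : CubicForm) : CubicForm :=
  ⟨PlaneCubic.changeCoords g f.1, changeCoords_isHomogeneous g f.2⟩

namespace PlaneCubic

/-- A projective change of coordinates, on plane cubics. -/
def map (g : GL (Fin 3) ℂ) : PlaneCubic → PlaneCubic :=
  Quotient.lift (fun f => V (f.changeCoords g)) (by
    intro f f' hff'
    obtain ⟨c, rfl⟩ := MulAction.orbitRel_apply.mp hff'
    exact V_eq_V_iff.mpr ⟨c, Subtype.ext (changeCoords_smul g (c : ℂ) f'.1).symm⟩)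

theorem map_V (g : GL (Fin 3) ℂ) (f : CubicForm) : map g (V f) = V (f.changeCoords g) := rfl

theorem semiconj_map_hesse (g : GL (Fin 3) ℂ) : Function.Semiconj (map g) hesse hesse := by
  intro E
  induction E using Quotient.inductionOn with
  | _ f =>
    change map g (hesse (V f)) = hesse (map g (V f))
    rw [hesse_V, map_V, map_V, hesse_V]
    have hdet : g.1.det ≠ 0 := (Matrix.isUnit_iff_isUnit_det _).mp g.isUnit |>.ne_zero
    refine (V_eq_V_iff.mpr ⟨Units.mk0 (g.1.det ^ 2) (pow_ne_zero 2 hdet), ?_⟩).symm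
    exact Subtype.ext (hessian_changeCoords g f.1).symm

theorem mem_periodicPts_map {E : PlaneCubic} (hE : E ∈ Function.periodicPts hesse)
    (g : GL (Fin 3) ℂ) : map g E ∈ Function.periodicPts hesse :=
  (semiconj_map_hesse g).mapsTo_periodicPts hE

end PlaneCubic

/-! ### The Hesse pencil -/

/-- The member `x³ + y³ + z³ - 3kxyz` of the Hesse pencil. -/
def hessePencil (k : ℂ) : CubicForm :=
  ⟨X 0 ^ 3 + X 1 ^ 3 + X 2 ^ 3 - C (3 * k) * (X 0 * X 1 * X 2), by
    have hX (i : Fin 3) : (X i ^ 3 : MvPolynomial (Fin 3) ℂ).IsHomogeneous 3 :=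
      isHomogeneous_X_pow i 3
    refine (((hX 0).add (hX 1)).add (hX 2)).sub ?_
    have h : (X 0 * X 1 * X 2 : MvPolynomial (Fin 3) ℂ).IsHomogeneous (1 + 1 + 1) :=
      ((isHomogeneous_X _ _).mul (isHomogeneous_X _ _)).mul (isHomogeneous_X _ _)
    exact h.C_mul _⟩

/-- The action of the Hesse derivative on the parameter of the Hesse pencil. -/
def hesseParam (k : ℂ) : ℂ := (4 - k ^ 3) / (3 * k ^ 2)

/-- The `j`-invariant as a function of the parameter of the Hesse pencil. -/
def pencilJ (k : ℂ) : ℂ := 27 * k ^ 3 * (k ^ 3 + 8) ^ 3 / (k ^ 3 - 1) ^ 3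

theorem hessian_hessePencil_coe (k : ℂ) :
    hessian (hessePencil k).1 = C (-54 * k ^ 2) * (X 0 ^ 3 + X 1 ^ 3 + X 2 ^ 3) +
      C (54 * (4 - k ^ 3)) * (X 0 * X 1 * X 2) := by
  have h3 (i : Fin 3) : pderiv i (3 : MvPolynomial (Fin 3) ℂ) = 0 := (pderiv i).map_natCast 3
  rw [hessian, Matrix.det_fin_three]
  simp [hessePencil, Derivation.leibniz, Derivation.leibniz_pow, h3, map_ofNat C]
  ring

/-- At `k = 0` the Hessian is a multiple of `xyz`, the member at `k = ∞`, which this parametrization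
omits. -/
theorem hesse_hessePencil {k : ℂ} (hk : k ≠ 0) :
    PlaneCubic.hesse (PlaneCubic.V (hessePencil k)) = PlaneCubic.V (hessePencil (hesseParam k)) := by
  rw [PlaneCubic.hesse_V, PlaneCubic.V_eq_V_iff]
  refine ⟨Units.mk0 (-54 * k ^ 2) (by simp [hk]), Subtype.ext ?_⟩
  change (-54 * k ^ 2) • (hessePencil (hesseParam k)).1 = hessian (hessePencil k).1
  have hc : (54 * (4 - k ^ 3)) = -(-54 * k ^ 2 * (3 * hesseParam k)) := by
    unfold hesseParam
    field_simp
  rw [hessian_hessePencil_coe, hc, smul_eq_C_mul, hessePencil, C_neg, C_mul (a := -54 * k ^ 2)]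
  ring

theorem pencilJ_eq_zero_iff {k : ℂ} (hk : k ^ 3 ≠ 1) :
    pencilJ k = 0 ↔ k = 0 ∨ k ^ 3 = -8 := by
  simp [pencilJ, sub_ne_zero.mpr hk, add_eq_zero_iff_eq_neg]

theorem hesseParam_pow_three_ne_one {k : ℂ} (hk : k ^ 3 ≠ 1) (hj : pencilJ k ≠ 0) :
    hesseParam k ^ 3 ≠ 1 := by
  rw [Ne, pencilJ_eq_zero_iff hk, not_or] at hj
  obtain ⟨h0, h8⟩ := hj
  intro h
  rw [hesseParam, div_pow, div_eq_one_iff_eq (by simp [h0])] at h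
  -- With `K = k³`: `(4 - K)³ - 27K² = -(K - 1)(K + 8)²`.
  have : (k ^ 3 - 1) * (k ^ 3 + 8) ^ 2 = 0 := by linear_combination -h
  simp [sub_eq_zero, hk, add_eq_zero_iff_eq_neg, h8] at this

theorem hesseJ_pencilJ {k : ℂ} (hk : k ^ 3 ≠ 1) (hj : pencilJ k ≠ 0) :
    hesseJ (pencilJ k : OnePoint ℂ) = (pencilJ (hesseParam k) : OnePoint ℂ) := by
  change (if pencilJ k = 0 then OnePoint.infty else
    (((6912 - pencilJ k) ^ 3 / (27 * pencilJ k ^ 2) : ℂ) : OnePoint ℂ)) = _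
  rw [if_neg hj]
  congr 1
  have h1 := hesseParam_pow_three_ne_one hk hj
  rw [Ne, pencilJ_eq_zero_iff hk, not_or] at hj
  obtain ⟨h0, h8⟩ := hj
  have hk1 := sub_ne_zero.mpr hk
  have hk8 : k ^ 3 + 8 ≠ 0 := fun h => h8 (add_eq_zero_iff_eq_neg.mp h)
  have hd : hesseParam k ^ 3 - 1 = -((k ^ 3 - 1) * (k ^ 3 + 8) ^ 2) / (27 * k ^ 6) := by
    unfold hesseParam
    field_simp
    ring
  have h3 : hesseParam k ^ 3 = (4 - k ^ 3) ^ 3 / (27 * k ^ 6) := by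
    unfold hesseParam
    field_simp
    ring
  -- The factor `4 - k³` is the numerator of `hesseParam k`, and the cubic in `k³` is that of
  -- `hesseParam k ^ 3 + 8`.
  have h4 : 6912 - pencilJ k =
      -27 * (4 - k ^ 3) * (64 - 48 * k ^ 3 + 228 * k ^ 6 - k ^ 9) / (k ^ 3 - 1) ^ 3 := by
    unfold pencilJ
    field_simp
    ring
  rw [h4, pencilJ, pencilJ, hd, h3]
  field_simp
  ring

/-! ### Parameters with periodic `j`-invariant -/

theorem hesseJ_infty : hesseJ OnePoint.infty = OnePoint.infty := rfl

/-- The orbit of `0` goes to the fixed point `∞` and stays there. -/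
theorem zero_notMem_periodicPts_hesseJ :
    ((0 : ℂ) : OnePoint ℂ) ∉ Function.periodicPts hesseJ := by
  rintro ⟨n, hn, h⟩
  obtain ⟨m, rfl⟩ := Nat.exists_eq_succ_of_ne_zero hn.ne'
  have h0 : hesseJ ((0 : ℂ) : OnePoint ℂ) = OnePoint.infty := if_pos rfl
  rw [Function.IsPeriodicPt, Function.IsFixedPt, Function.iterate_succ_apply, h0,
    Function.iterate_fixed hesseJ_infty] at h
  exact OnePoint.infty_ne_coe _ h

/-- The parameters of smooth members of the Hesse pencil with periodic `j`-invariant. -/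
def periodicParams : Set ℂ :=
  {k | k ^ 3 ≠ 1 ∧ (pencilJ k : OnePoint ℂ) ∈ Function.periodicPts hesseJ}

theorem pencilJ_ne_zero {k : ℂ} (hk : k ∈ periodicParams) : pencilJ k ≠ 0 := fun h =>
  zero_notMem_periodicPts_hesseJ (h ▸ hk.2)

theorem periodicParams_ne {k : ℂ} (hk : k ∈ periodicParams) : k ≠ 0 ∧ k ^ 3 ≠ -8 :=
  not_or.mp fun h => pencilJ_ne_zero hk ((pencilJ_eq_zero_iff hk.1).mpr h)

theorem hesseParam_mem {k : ℂ} (hk : k ∈ periodicParams) : hesseParam k ∈ periodicParams := by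
  have hj := pencilJ_ne_zero hk
  refine ⟨hesseParam_pow_three_ne_one hk.1 hj, ?_⟩
  rw [← hesseJ_pencilJ hk.1 hj]
  exact Function.Semiconj.mapsTo_periodicPts (Function.Commute.refl hesseJ) hk.2

theorem iterate_hesseParam_mem {k : ℂ} (hk : k ∈ periodicParams) (n : ℕ) :
    hesseParam^[n] k ∈ periodicParams :=
  Set.MapsTo.iterate (fun _ => hesseParam_mem) n hk

theorem iterate_hesseJ_pencilJ {k : ℂ} (hk : k ∈ periodicParams) (n : ℕ) :
    hesseJ^[n] (pencilJ k : OnePoint ℂ) = (pencilJ (hesseParam^[n] k) : OnePoint ℂ) := by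
  induction n with
  | zero => rfl
  | succ n ih =>
    have h := iterate_hesseParam_mem hk n
    rw [Function.iterate_succ_apply', ih, hesseJ_pencilJ h.1 (pencilJ_ne_zero h),
      Function.iterate_succ_apply']

theorem iterate_hesse_hessePencil {k : ℂ} (hk : k ∈ periodicParams) (n : ℕ) :
    PlaneCubic.hesse^[n] (PlaneCubic.V (hessePencil k)) =
      PlaneCubic.V (hessePencil (hesseParam^[n] k)) := by
  induction n with
  | zero => rfl
  | succ n ih =>
    rw [Function.iterate_succ_apply', ih,
      hesse_hessePencil (periodicParams_ne (iterate_hesseParam_mem hk n)).1,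
      Function.iterate_succ_apply']

/-! ### Symmetries of the Hesse pencil -/

/-- A symmetry of the periodic part of the Hesse pencil: a map of the parameter that preserves the
`j`-invariant and commutes with the Hesse derivative. -/
structure IsPencilSymmetry (d : ℂ → ℂ) : Prop where
  pow_three_ne_one : ∀ k ∈ periodicParams, d k ^ 3 ≠ 1
  pencilJ_eq : ∀ k ∈ periodicParams, pencilJ (d k) = pencilJ k
  commute : ∀ k ∈ periodicParams, hesseParam (d k) = d (hesseParam k)

namespace IsPencilSymmetry

theorem mem {d : ℂ → ℂ} (hd : IsPencilSymmetry d) {k : ℂ} (hk : k ∈ periodicParams) :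
    d k ∈ periodicParams :=
  ⟨hd.pow_three_ne_one k hk, by rw [hd.pencilJ_eq k hk]; exact hk.2⟩

theorem comp {d e : ℂ → ℂ} (hd : IsPencilSymmetry d) (he : IsPencilSymmetry e) :
    IsPencilSymmetry (d ∘ e) where
  pow_three_ne_one _ hk := hd.pow_three_ne_one _ (he.mem hk)
  pencilJ_eq _ hk := (hd.pencilJ_eq _ (he.mem hk)).trans (he.pencilJ_eq _ hk)
  commute k hk := by
    simp only [Function.comp_apply]
    rw [hd.commute _ (he.mem hk), he.commute _ hk]

theorem iterate_commute {d : ℂ → ℂ} (hd : IsPencilSymmetry d) {k : ℂ} (hk : k ∈ periodicParams)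
    (n : ℕ) : hesseParam^[n] (d k) = d (hesseParam^[n] k) := by
  induction n with
  | zero => rfl
  | succ n ih =>
    rw [Function.iterate_succ_apply', ih, hd.commute _ (iterate_hesseParam_mem hk n),
      Function.iterate_succ_apply']

/-- Geometrically, one coordinate is rescaled by a cube root of unity. -/
theorem mul_left {w : ℂ} (hw : w ^ 3 = 1) : IsPencilSymmetry (w * ·) where
  pow_three_ne_one k hk := by simpa [mul_pow, hw] using hk.1
  pencilJ_eq k _ := by simp [pencilJ, mul_pow, hw]
  commute k hk := by
    have h0 := (periodicParams_ne hk).1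
    have hw0 : w ≠ 0 := by rintro rfl; simp at hw
    simp only [hesseParam, mul_pow, hw]
    field_simp
    linear_combination (k ^ 3 - 4) * hw

/-- This Möbius map comes from the discrete Fourier transform `x + y + z`, `x + ωy + ω²z`, `x + ω²y
+ ωz` of the coordinates, which permutes the members of the pencil. -/
theorem add_two_div_sub_one : IsPencilSymmetry fun k => (k + 2) / (k - 1) where
  pow_three_ne_one k hk := by
    have hk1 : k - 1 ≠ 0 := fun h => hk.1 (by rw [sub_eq_zero.mp h, one_pow])
    intro h
    rw [div_pow, div_eq_one_iff_eq (pow_ne_zero 3 hk1)] at h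
    have h9 : (k ^ 2 + k + 1) * 9 = 0 := by linear_combination h
    exact hk.1 (by linear_combination (k - 1) / 9 * h9)
  pencilJ_eq k hk := by
    have hk1 : k - 1 ≠ 0 := fun h => hk.1 (by rw [sub_eq_zero.mp h, one_pow])
    have hk2 : k ^ 2 + k + 1 ≠ 0 := fun h => hk.1 (by linear_combination (k - 1) * h)
    have e1 : ((k + 2) / (k - 1)) ^ 3 - 1 = 9 * (k ^ 2 + k + 1) / (k - 1) ^ 3 := by
      field_simp
      ring
    have e2 : ((k + 2) / (k - 1)) ^ 3 + 8 = 9 * k * (k ^ 2 - 2 * k + 4) / (k - 1) ^ 3 := by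
      field_simp
      ring
    have e3 : k ^ 3 - 1 = (k - 1) * (k ^ 2 + k + 1) := by ring
    rw [pencilJ, pencilJ, e1, e2, e3]
    field_simp
    ring
  commute k hk := by
    obtain ⟨h0, h8⟩ := periodicParams_ne hk
    have hk1 : k - 1 ≠ 0 := fun h => hk.1 (by rw [sub_eq_zero.mp h, one_pow])
    have hk2 : k + 2 ≠ 0 := fun h => h8 (by rw [eq_neg_of_add_eq_zero_left h]; norm_num)
    have e1 : hesseParam k + 2 = -(k ^ 3 - 6 * k ^ 2 - 4) / (3 * k ^ 2) := by
      unfold hesseParam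
      field_simp
      ring
    have e2 : hesseParam k - 1 = -((k - 1) * (k + 2) ^ 2) / (3 * k ^ 2) := by
      unfold hesseParam
      field_simp
      ring
    rw [e1, e2, hesseParam]
    field_simp
    ring

end IsPencilSymmetry

theorem exists_mul_of_pow_three_eq {a b : ℂ} (ha : a ≠ 0) (h : b ^ 3 = a ^ 3) :
    ∃ w : ℂ, w ^ 3 = 1 ∧ b = w * a :=
  ⟨b / a, by rw [div_pow, h, div_self (pow_ne_zero 3 ha)], by field_simp⟩

/-- The symmetries of the Hesse pencil act transitively on the members with a given `j`. -/
theorem exists_isPencilSymmetry {k l : ℂ} (hk : k ∈ periodicParams) (hl : l ∈ periodicParams)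
    (h : pencilJ l = pencilJ k) : ∃ d, IsPencilSymmetry d ∧ l = d k := by
  obtain ⟨w, hw⟩ : ∃ w : ℂ, w ^ 2 + w + 1 = 0 := by
    have hp : (Polynomial.X ^ 2 + Polynomial.X + 1 : Polynomial ℂ).degree = 2 := by compute_degree!
    obtain ⟨w, hw⟩ := IsAlgClosed.exists_root (Polynomial.X ^ 2 + Polynomial.X + 1 : Polynomial ℂ)
      (by rw [hp]; decide)
    exact ⟨w, by simpa using hw⟩
  have hw3 : w ^ 3 = 1 := by linear_combination (w - 1) * hw
  have h0 := (periodicParams_ne hk).1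
  have moebius {v : ℂ} (hv : v ^ 3 = 1)
      (e : (v * k - 1) ^ 3 * l ^ 3 - (v * k + 2) ^ 3 = 0) :
      ∃ d, IsPencilSymmetry d ∧ l = d k := by
    have hs := IsPencilSymmetry.add_two_div_sub_one.comp (IsPencilSymmetry.mul_left hv)
    have hne := (periodicParams_ne (hs.mem hk)).1
    -- Division by zero would give the parameter `0`, which is not periodic.
    have h1 : v * k - 1 ≠ 0 := fun h1 => hne (by simp [h1])
    obtain ⟨u, hu, hlu⟩ := exists_mul_of_pow_three_eq (b := l) hne (by
      simp only [Function.comp_apply, div_pow]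
      rw [eq_div_iff (pow_ne_zero 3 h1)]
      linear_combination e)
    exact ⟨_, (IsPencilSymmetry.mul_left hu).comp hs, hlu⟩
  -- The equation `pencilJ l = pencilJ k` has degree 4 in `l³`; its roots are `k³` and the cubes of
  -- `(vk + 2)/(vk - 1)` for the three cube roots of unity `v`.
  have hfac : (l ^ 3 - k ^ 3) * (((1 * k - 1) ^ 3 * l ^ 3 - (1 * k + 2) ^ 3) *
      ((w * k - 1) ^ 3 * l ^ 3 - (w * k + 2) ^ 3) *
      ((w ^ 2 * k - 1) ^ 3 * l ^ 3 - (w ^ 2 * k + 2) ^ 3)) = 0 := by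
    have hj : l ^ 3 * (l ^ 3 + 8) ^ 3 * (k ^ 3 - 1) ^ 3 -
        k ^ 3 * (k ^ 3 + 8) ^ 3 * (l ^ 3 - 1) ^ 3 = 0 := by
      rw [pencilJ, pencilJ, div_eq_div_iff (pow_ne_zero 3 (sub_ne_zero.mpr hl.1))
        (pow_ne_zero 3 (sub_ne_zero.mpr hk.1))] at h
      linear_combination h / 27
    have hP (v : ℂ) (hv : v ^ 3 = 1) : (v * k - 1) ^ 3 * l ^ 3 - (v * k + 2) ^ 3 =
        (k ^ 3 - 1) * l ^ 3 - (k ^ 3 + 8) + v * (3 * k * l ^ 3 - 12 * k) +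
          v ^ 2 * (-3 * k ^ 2 * l ^ 3 - 6 * k ^ 2) := by
      linear_combination (k ^ 3 * l ^ 3 - k ^ 3) * hv
    -- Sorted by powers of `v`, the three factors are conjugate, so their product is a norm free of
    -- `w`.
    have hnorm (a b c : ℂ) : (a + 1 * b + 1 ^ 2 * c) * (a + w * b + w ^ 2 * c) *
        (a + w ^ 2 * b + (w ^ 2) ^ 2 * c) = a ^ 3 + b ^ 3 + c ^ 3 - 3 * a * b * c := by
      have e2 : w ^ 2 = -1 - w := by linear_combination hw
      have e4 : (w ^ 2) ^ 2 = w := by linear_combination w * hw3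
      rw [e4, e2]
      linear_combination (-a * b ^ 2 + 2 * a * b * c - a * c ^ 2 + b * c ^ 2 + b ^ 2 * c - b ^ 3 - c ^ 3) * hw
    rw [hP 1 (one_pow 3), hP w hw3, hP (w ^ 2) (by rw [← pow_mul, mul_comm, pow_mul, hw3, one_pow]),
      hnorm]
    linear_combination hj
  rcases mul_eq_zero.mp hfac with e | e
  · obtain ⟨u, hu, hlu⟩ := exists_mul_of_pow_three_eq h0 (sub_eq_zero.mp e)
    exact ⟨_, IsPencilSymmetry.mul_left hu, hlu⟩
  rcases mul_eq_zero.mp e with e | e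
  · rcases mul_eq_zero.mp e with e | e
    · exact moebius (one_pow 3) e
    · exact moebius hw3 e
  · exact moebius (by rw [← pow_mul, mul_comm, pow_mul, hw3, one_pow]) e

/-! ### From periodic `j` to periodic parameter -/

theorem finite_pencilJ_fiber (j : ℂ) : {k : ℂ | k ^ 3 ≠ 1 ∧ pencilJ k = j}.Finite := by
  let p : Polynomial ℂ := 27 * Polynomial.X ^ 3 * (Polynomial.X ^ 3 + 8) ^ 3 -
    Polynomial.C j * (Polynomial.X ^ 3 - 1) ^ 3
  have hp : p ≠ 0 := by
    intro h
    -- At `1` the value is `27 · 9³`, independent of `j`.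
    have := congrArg (Polynomial.eval 1) h
    norm_num [p] at this
  refine (p.rootSet_finite ℂ).subset fun k hk => ?_
  rw [Polynomial.mem_rootSet_of_ne hp]
  have := hk.2
  rw [pencilJ, div_eq_iff (pow_ne_zero 3 (sub_ne_zero.mpr hk.1))] at this
  simp [p, this]

theorem mem_periodicPts_hesseParam {k : ℂ} (hk : k ∈ periodicParams) :
    k ∈ Function.periodicPts hesseParam := by
  obtain ⟨m, hm, hper⟩ := hk.2
  let F : Set ℂ := {l | l ^ 3 ≠ 1 ∧ pencilJ l = pencilJ k}
  have hFP {l : ℂ} (hl : l ∈ F) : l ∈ periodicParams := ⟨hl.1, by rw [hl.2]; exact hk.2⟩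
  have hmaps : Set.MapsTo hesseParam^[m] F F := fun l hl => by
    have hlP := hFP hl
    refine ⟨(iterate_hesseParam_mem hlP m).1, ?_⟩
    have := iterate_hesseJ_pencilJ hlP m
    rw [hl.2, hper.eq] at this
    exact (OnePoint.coe_injective this).symm
  have hkF : k ∈ F := ⟨hk.1, rfl⟩
  have : Finite F := (finite_pencilJ_fiber (pencilJ k)).to_subtype
  -- Writing `l = d (hesseParam^[m] k)` with `d` a symmetry, commutation shows that `d k` is a
  -- preimage of `l`.
  have hsurj : Function.Surjective hmaps.restrict := fun ⟨l, hl⟩ => by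
    obtain ⟨d, hd, hld⟩ := exists_isPencilSymmetry (hFP (hmaps hkF)) (hFP hl)
      (hl.2.trans (hmaps hkF).2.symm)
    refine ⟨⟨d k, hd.pow_three_ne_one k hk, hd.pencilJ_eq k hk⟩, Subtype.ext ?_⟩
    simpa only [Set.MapsTo.val_restrict_apply, hld] using hd.iterate_commute hk m
  obtain ⟨r, hr, hrk⟩ := (Finite.injective_iff_surjective.mpr hsurj).mem_periodicPts ⟨k, hkF⟩
  refine ⟨m * r, Nat.mul_pos hm hr, ?_⟩
  have hval : Function.Semiconj (Subtype.val : F → ℂ) hmaps.restrict hesseParam^[m] := fun _ => rfl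
  have := hrk.map hval
  rwa [Function.IsPeriodicPt, ← Function.iterate_mul] at this

theorem hessePencil_mem_periodicPts {k : ℂ} (hk : k ∈ periodicParams) :
    PlaneCubic.V (hessePencil k) ∈ Function.periodicPts PlaneCubic.hesse := by
  obtain ⟨n, hn, h⟩ := mem_periodicPts_hesseParam hk
  exact ⟨n, hn, (iterate_hesse_hessePencil hk n).trans (by rw [h.eq])⟩

/-! ### From Weierstrass forms to the Hesse pencil -/

/-- Clearing denominators gives a quartic in `k³` with leading coefficient `27`, and `k³ = 1` is not
a root. -/
theorem exists_pencilJ_eq (j : ℂ) : ∃ k : ℂ, k ^ 3 ≠ 1 ∧ pencilJ k = j := by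
  let p : Polynomial ℂ := 27 * Polynomial.X * (Polynomial.X + 8) ^ 3 -
    Polynomial.C j * (Polynomial.X - 1) ^ 3
  have hp : p.degree = 4 := by
    have h : p = Polynomial.C 27 * Polynomial.X ^ 4 + Polynomial.C (648 - j) * Polynomial.X ^ 3 +
        Polynomial.C (5184 + 3 * j) * Polynomial.X ^ 2 +
        Polynomial.C (13824 - 3 * j) * Polynomial.X + Polynomial.C j := by
      simp only [p, map_sub, map_add, map_mul, map_ofNat]
      ring
    rw [h]
    compute_degree!
  obtain ⟨K, hK⟩ := IsAlgClosed.exists_root p (by rw [hp]; decide)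
  obtain ⟨k, rfl⟩ := IsAlgClosed.exists_pow_nat_eq K (n := 3) (by norm_num)
  simp only [Polynomial.IsRoot.def, p, Polynomial.eval_sub, Polynomial.eval_mul,
    Polynomial.eval_add, Polynomial.eval_pow, Polynomial.eval_X, Polynomial.eval_C,
    Polynomial.eval_one, Polynomial.eval_ofNat] at hK
  have hk : k ^ 3 ≠ 1 := by
    intro h
    norm_num [h] at hK
  refine ⟨k, hk, ?_⟩
  rw [pencilJ, div_eq_iff (pow_ne_zero 3 (sub_ne_zero.mpr hk))]
  linear_combination hK

/-- The change of coordinates that takes a member of the Hesse pencil to a Weierstrass form. -/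
def pencilToWeierstrass (k s : ℂ) : Matrix (Fin 3) (Fin 3) ℂ :=
  !![-k / 2, s⁻¹, (k ^ 3 - 1) * s ^ 2 / 6 - k ^ 3 * s ^ 2 / 8;
     -k / 2, -s⁻¹, (k ^ 3 - 1) * s ^ 2 / 6 - k ^ 3 * s ^ 2 / 8;
     1, 0, k ^ 2 * s ^ 2 / 4]

theorem det_pencilToWeierstrass {k s : ℂ} (hs : s ≠ 0) :
    (pencilToWeierstrass k s).det = (k ^ 3 - 1) * s / 3 := by
  rw [pencilToWeierstrass, Matrix.det_fin_three]
  simp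
  field_simp
  ring

/-- The matrix sends the Weierstrass flex `(0 : 1 : 0)` to the flex `(1 : -1 : 0)` of the pencil and
the line `z = 0` to its tangent `x + y + kz = 0`. The sign change of `y` becomes the swap of `x` and
`y`; the last column removes the `x²z` term, and `s` is the free scaling. -/
theorem exists_changeCoords_hessePencil {k s : ℂ} (hk : k ^ 3 ≠ 1) (hs : s ≠ 0) :
    ∃ g : GL (Fin 3) ℂ, PlaneCubic.changeCoords g (hessePencil k).1 =
      (k ^ 3 - 1) • PlaneCubic.weierstrass (s ^ 4 * (-k * (k ^ 3 + 8) / 48))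
        (s ^ 6 * ((k ^ 6 - 20 * k ^ 3 - 8) / 864)) := by
  have hdet : (pencilToWeierstrass k s).det ≠ 0 := by
    rw [det_pencilToWeierstrass hs]
    simp [sub_ne_zero.mpr hk, hs]
  refine ⟨Matrix.GeneralLinearGroup.mkOfDetNeZero _ hdet, ?_⟩
  refine MvPolynomial.funext fun v => ?_
  simp [PlaneCubic.changeCoords, hessePencil, PlaneCubic.weierstrass, Fin.sum_univ_three,
    Matrix.GeneralLinearGroup.mkOfDetNeZero, pencilToWeierstrass, smul_eval]
  field_simp
  ring

/-- A fourth root of `a / a'` matches `b` up to sign; replacing `s` by `i s` keeps `s⁴` and negates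
`s⁶`. -/
theorem exists_scaling {a b a' b' : ℂ} (ha : a ≠ 0) (ha' : a' ≠ 0)
    (h : a ^ 3 * b' ^ 2 = a' ^ 3 * b ^ 2) :
    ∃ s : ℂ, s ≠ 0 ∧ a = s ^ 4 * a' ∧ b = s ^ 6 * b' := by
  obtain ⟨s, hs⟩ := IsAlgClosed.exists_pow_nat_eq (a / a') (n := 4) (by norm_num)
  have hs0 : s ≠ 0 := by
    rintro rfl
    exact div_ne_zero ha ha' (by rw [← hs]; norm_num)
  have hsa : a = s ^ 4 * a' := by rw [hs]; field_simp
  have hb : b ^ 2 = (s ^ 6 * b') ^ 2 := by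
    refine mul_left_cancel₀ (pow_ne_zero 3 ha') ?_
    rw [← h, hsa]
    ring
  rcases sq_eq_sq_iff_eq_or_eq_neg.mp hb with hb | hb
  · exact ⟨s, hs0, hsa, hb⟩
  · refine ⟨Complex.I * s, mul_ne_zero Complex.I_ne_zero hs0, ?_, ?_⟩
    · rw [mul_pow, Complex.I_pow_four, one_mul, hsa]
    · have : Complex.I ^ 6 = -1 := by
        rw [show 6 = 4 + 2 from rfl, pow_add, Complex.I_pow_four, Complex.I_sq, one_mul]
      rw [mul_pow, this, hb]
      ring

theorem exists_changeCoords_hessePencil_eq_weierstrass {a b k : ℂ}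
    (hab : 4 * a ^ 3 + 27 * b ^ 2 ≠ 0) (ha : a ≠ 0) (hk : k ^ 3 ≠ 1)
    (hj : pencilJ k = 1728 * (4 * a ^ 3 / (4 * a ^ 3 + 27 * b ^ 2))) :
    ∃ g : GL (Fin 3) ℂ, PlaneCubic.changeCoords g (hessePencil k).1 =
      (k ^ 3 - 1) • PlaneCubic.weierstrass a b := by
  have hk1 := sub_ne_zero.mpr hk
  have hj0 : pencilJ k ≠ 0 := by simp [hj, hab, ha]
  rw [Ne, pencilJ_eq_zero_iff hk, not_or] at hj0
  obtain ⟨h0, h8⟩ := hj0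
  have ha' : -k * (k ^ 3 + 8) / 48 ≠ 0 := by simp [h0, add_eq_zero_iff_eq_neg, h8]
  have key : a ^ 3 * ((k ^ 6 - 20 * k ^ 3 - 8) / 864) ^ 2 =
      (-k * (k ^ 3 + 8) / 48) ^ 3 * b ^ 2 := by
    rw [pencilJ, ← mul_div_assoc, div_eq_div_iff (pow_ne_zero 3 hk1) hab] at hj
    -- With `K = k³`, this rests on `K(K + 8)³ - 64(K - 1)³ = (K² - 20K - 8)²`; the constant is `108
    -- · 864²`.
    linear_combination (1 / 80621568) * hj
  obtain ⟨s, hs, rfl, rfl⟩ := exists_scaling ha ha' key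
  exact exists_changeCoords_hessePencil hk hs

theorem PlaneCubic.HasWeierstrassForm.exists_map_hessePencil {E : PlaneCubic} {a b k : ℂ}
    (hE : E.HasWeierstrassForm a b) (hab : 4 * a ^ 3 + 27 * b ^ 2 ≠ 0) (ha : a ≠ 0)
    (hk : k ^ 3 ≠ 1) (hj : pencilJ k = 1728 * (4 * a ^ 3 / (4 * a ^ 3 + 27 * b ^ 2))) :
    ∃ g, E = PlaneCubic.map g (PlaneCubic.V (hessePencil k)) := by
  obtain ⟨f, g, rfl, hf⟩ := hE
  obtain ⟨g', hg'⟩ := exists_changeCoords_hessePencil_eq_weierstrass hab ha hk hj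
  refine ⟨g' * g⁻¹, ?_⟩
  rw [map_V, eq_comm, V_eq_V_iff]
  refine ⟨Units.mk0 (k ^ 3 - 1) (sub_ne_zero.mpr hk), Subtype.ext ?_⟩
  change (k ^ 3 - 1) • f.1 = changeCoords (g' * g⁻¹) (hessePencil k).1
  rw [← changeCoords_changeCoords, hg', ← hf, changeCoords_smul, changeCoords_changeCoords,
    mul_inv_cancel, changeCoords_one]

/-- Both a missing Weierstrass form and a vanishing discriminant give `∞`, so a finite value
excludes both. The form obtained is the one chosen in `jInvariant`, so independence of that choice
is not needed. -/
theorem PlaneCubic.exists_weierstrass_of_jInvariant_eq_coe {E : PlaneCubic} {j : ℂ}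
    (hj : E.jInvariant = (j : OnePoint ℂ)) :
    ∃ a b, E.HasWeierstrassForm a b ∧ 4 * a ^ 3 + 27 * b ^ 2 ≠ 0 ∧
      j = 1728 * (4 * a ^ 3 / (4 * a ^ 3 + 27 * b ^ 2)) := by
  unfold jInvariant at hj
  split_ifs at hj with h
  · refine ⟨_, _, h.choose_spec, ?_⟩
    unfold jOfWeierstrass at hj
    split_ifs at hj with h0
    · exact absurd hj (OnePoint.infty_ne_coe _)
    · exact ⟨h0, (OnePoint.coe_injective hj).symm⟩
  · exact absurd hj (OnePoint.infty_ne_coe _)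

end

theorem mainTheorem5 (E : PlaneCubic) (hE : E.IsSmooth)
    (j : ℂ) (hj : E.jInvariant = (j : OnePoint ℂ))
    (hper : (j : OnePoint ℂ) ∈ Function.periodicPts hesseJ) :
    ∃ n : ℕ, 0 < n ∧ PlaneCubic.hesse^[n] E = E := by
  obtain ⟨a, b, hW, hab, hjab⟩ := PlaneCubic.exists_weierstrass_of_jInvariant_eq_coe hj
  -- If `a = 0` then `j = 0`, which is not periodic.
  have ha : a ≠ 0 := by
    rintro rfl
    exact zero_notMem_periodicPts_hesseJ (by simpa [hjab] using hper)
  obtain ⟨k, hk, hkj⟩ := exists_pencilJ_eq j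
  obtain ⟨g, rfl⟩ := hW.exists_map_hessePencil hab ha hk (hkj.trans hjab)
  exact PlaneCubic.mem_periodicPts_map (hessePencil_mem_periodicPts ⟨hk, by rwa [hkj]⟩) g
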